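/- Let $\mathscr A$ be a complex unital C*-algebra with $1\neq 0$, and let $\mathscr E$ be a (right) Hilbert C*-module over $\mathscr A$, with $\mathscr A$-valued inner product $\langle\cdot|\cdot\rangle$ (conjugate linear in the first variable, linear in the second, $\langle x|ya\rangle=\langle x|y\rangle a$) and norm $\|x\|=\|\langle x|x\rangle\|^{1/2}$. Let $e\in\mathscr E$ and let $\mathscr F$ be a complex linear subspace of $\mathscr E$. Say that $e$ is Birkhoff–James orthogonal to $\mathscr F$ if $\|e\|\le\|e+kf\|$ for all $f\in\mathscr F$ and all $k\in\mathbb C$, and call a linear functional $\phi:\mathscr A\to\mathbb C$ a state if $\phi(1)=1$ and $\phi(a)$ is a non-negative real number for every positive $a\in\mathscr A$. Then $e$ is Birkhoff–James orthogonal to $\mathscr F$ if and only if there exists a state $\phi$ on $\mathscr A$ such that $\phi(\langle e|e\rangle)=\|e\|^2$ and $\phi(\langle e|f\rangle)=0$ for all $f\in\mathscr F$. -/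

import Mathlib

open scoped ComplexOrder

/-- In a normed space over `𝕜`, `v` is Birkhoff-James orthogonal to `u` if `‖v‖ ≤ ‖v + k u‖` for
every scalar `k`. -/
def IsBirkhoffJamesOrthogonal (𝕜 : Type*) {V : Type*} [NormedField 𝕜] [NormedAddCommGroup V]
    [NormedSpace 𝕜 V] (v u : V) : Prop :=
  ∀ k : 𝕜, ‖v‖ ≤ ‖v + k • u‖

/-- `v` is Birkhoff-James orthogonal to a subspace `W` if it is Birkhoff-James orthogonal to every
element of `W`. -/
def IsBirkhoffJamesOrthogonalTo {𝕜 V : Type*} [NormedField 𝕜] [NormedAddCommGroup V]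
    [NormedSpace 𝕜 V] (v : V) (W : Submodule 𝕜 V) : Prop :=
  ∀ w ∈ W, IsBirkhoffJamesOrthogonal 𝕜 v w

/-- The set of states of a unital complex C⋆-algebra: the linear functionals that take `1` to `1`
and positive elements to non-negative real numbers (`0 ≤ z` in `ℂ` means that `z` is real and
non-negative). -/
def stateSet (A : Type*) [CStarAlgebra A] [PartialOrder A] : Set (A →ₗ[ℂ] ℂ) :=
  {φ | φ 1 = 1 ∧ ∀ a : A, 0 ≤ a → 0 ≤ φ a}

/-- The `A`-valued inner product `⟨x | y⟩` of a right Hilbert C⋆-module over `A`.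

Mathlib's `CStarModule B E` asks for `⟪x, b • y⟫ = b * ⟪x, y⟫`, so a right Hilbert C⋆-module over
`A` is a `CStarModule` over the opposite algebra `Aᵐᵒᵖ`, whose scalars act on `E` from the right:
with `y a := MulOpposite.op a • y` the product below satisfies `⟨x | y a⟩ = ⟨x | y⟩ a`. It is
linear in `y`, conjugate linear in `x`, and on `A` itself it is `star x * y`. -/
def rightInner (A : Type*) {E : Type*} [Inner Aᵐᵒᵖ E] (x y : E) : A :=
  MulOpposite.unop (inner Aᵐᵒᵖ x y)

/-! If a state `φ` satisfies the two conditions and `g ∈ F`, expanding gives `φ ⟨e+g|e+g⟩ = ‖e‖² + φ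
⟨g|g⟩ ≥ ‖e‖²`, while `φ ⟨x|x⟩ ≤ ‖x‖²` always. Conversely, cone separation
(`exists_mem_stateSet_re_nonneg`) yields a state with non-negative real part on the cone generated
by all `⟨e|f⟩` and `⟨e|e⟩ - ‖e‖²`. Since `F` is a complex subspace, this forces `φ ⟨e|f⟩ = 0`; the
last generator forces `φ ⟨e|e⟩ = ‖e‖²`. The only obstruction would be a cone element with real part
below a negative scalar, and then `‖e + k f‖ < ‖e‖` for small `k > 0`. -/

section RightInner

variable {A E : Type*} [CStarAlgebra A] [PartialOrder A]
  [NormedAddCommGroup E] [NormedSpace ℂ E] [Module Aᵐᵒᵖ E] [CStarModule Aᵐᵒᵖ E]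

theorem rightInner_add_right (x y z : E) :
    rightInner A x (y + z) = rightInner A x y + rightInner A x z := by
  simp [rightInner]

theorem rightInner_smul_right (k : ℂ) (x y : E) :
    rightInner A x (k • y) = k • rightInner A x y := by
  simp [rightInner]

theorem star_rightInner (x y : E) : star (rightInner A x y) = rightInner A y x := by
  rw [rightInner, ← MulOpposite.unop_star, CStarModule.star_inner, rightInner]

theorem rightInner_add_left (x y z : E) :
    rightInner A (x + y) z = rightInner A x z + rightInner A y z := by
  rw [← star_rightInner, rightInner_add_right, star_add, star_rightInner, star_rightInner]

theorem rightInner_self_nonneg (x : E) : 0 ≤ rightInner A x x :=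
  CStarModule.inner_self_nonneg (A := Aᵐᵒᵖ) (x := x)

theorem norm_rightInner_self (x : E) : ‖rightInner A x x‖ = ‖x‖ ^ 2 :=
  (CStarModule.norm_sq_eq Aᵐᵒᵖ (x := x)).symm

theorem rightInner_add_self (x y : E) :
    rightInner A (x + y) (x + y) = rightInner A x x
      + (rightInner A x y + star (rightInner A x y)) + rightInner A y y := by
  rw [rightInner_add_right, rightInner_add_left, rightInner_add_left, star_rightInner]
  abel

theorem rightInner_self_le [StarOrderedRing A] (x : E) :
    rightInner A x x ≤ algebraMap ℝ A (‖x‖ ^ 2) :=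
  norm_rightInner_self (A := A) x ▸
    IsSelfAdjoint.le_algebraMap_norm_self (.of_nonneg (rightInner_self_nonneg x))

end RightInner

section State

variable {A : Type*} [CStarAlgebra A] [PartialOrder A]

theorem stateSet.map_algebraMap {φ : A →ₗ[ℂ] ℂ} (hφ : φ ∈ stateSet A) (r : ℝ) :
    φ (algebraMap ℝ A r) = r := by
  rw [Algebra.algebraMap_eq_smul_one, ← Complex.coe_smul, map_smul, hφ.1, smul_eq_mul, mul_one]

theorem stateSet.im_eq_zero [StarOrderedRing A] {φ : A →ₗ[ℂ] ℂ} (hφ : φ ∈ stateSet A) {a : A}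
    (ha : IsSelfAdjoint a) : (φ a).im = 0 := by
  rw [← CFC.posPart_sub_negPart a ha, map_sub, Complex.sub_im,
    ← (Complex.le_def.1 (hφ.2 _ (CFC.posPart_nonneg a))).2,
    ← (Complex.le_def.1 (hφ.2 _ (CFC.negPart_nonneg a))).2, sub_self]

theorem stateSet.map_star [StarOrderedRing A] {φ : A →ₗ[ℂ] ℂ} (hφ : φ ∈ stateSet A) (a : A) :
    φ (star a) = star (φ a) := by
  have h₁ := stateSet.im_eq_zero hφ (IsSelfAdjoint.add_star_self a)
  have h₂ := stateSet.im_eq_zero hφ (a := Complex.I • (a - star a)) (by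
    simp [isSelfAdjoint_iff, add_comm, sub_eq_add_neg])
  simp only [map_add, map_smul, map_sub, Complex.add_im, smul_eq_mul, Complex.mul_im,
    Complex.I_re, Complex.I_im, Complex.sub_re, Complex.sub_im] at h₁ h₂
  apply Complex.ext
  · simp only [RCLike.star_def, Complex.conj_re]; linarith
  · simp only [RCLike.star_def, Complex.conj_im]; linarith

theorem nonneg_of_algebraMap_nonneg [Nontrivial A] [StarOrderedRing A] {r : ℝ}
    (h : 0 ≤ algebraMap ℝ A r) : 0 ≤ r := by
  by_contra! hr
  have h' : 0 ≤ algebraMap ℝ A (-r) := by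
    rw [Algebra.algebraMap_eq_smul_one]
    exact smul_nonneg (neg_nonneg.2 hr.le) zero_le_one
  rw [map_neg, neg_nonneg] at h'
  exact hr.ne ((map_eq_zero _).1 (le_antisymm h' h))

/-- A convex cone in a unital C⋆-algebra whose elements have real parts that are not bounded above
by negative scalars admits a state with non-negative real part on the cone. -/
theorem exists_mem_stateSet_re_nonneg [Nontrivial A] [StarOrderedRing A] (C : PointedCone ℝ A)
    (hC : ∀ c ∈ C, ∀ r : ℝ, c + star c ≤ algebraMap ℝ A r → 0 ≤ r) :
    ∃ φ ∈ stateSet A, ∀ c ∈ C, 0 ≤ (φ c).re := by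
  -- Comparing only real parts puts into `s` the cone `C`, the positive elements, and every
  -- skew-adjoint element with both signs; so a functional non-negative on `s` kills the
  -- skew-adjoint part.
  let s : PointedCone ℝ A :=
    { carrier := {a | ∃ c ∈ C, c + star c ≤ a + star a}
      zero_mem' := ⟨0, C.zero_mem, le_rfl⟩
      add_mem' := by
        rintro a b ⟨c, hc, hca⟩ ⟨d, hd, hdb⟩
        refine ⟨c + d, C.add_mem hc hd, ?_⟩
        rw [star_add, star_add, add_add_add_comm, add_add_add_comm a]
        exact add_le_add hca hdb
      smul_mem' := by
        rintro ⟨t, ht⟩ a ⟨c, hc, hca⟩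
        refine ⟨t • c, C.smul_mem ht hc, ?_⟩
        change t • c + star (t • c) ≤ t • a + star (t • a)
        rw [star_smul, star_smul, star_trivial, ← smul_add, ← smul_add]
        exact smul_le_smul_of_nonneg_left hca ht }
  let f : A →ₗ.[ℝ] ℝ := LinearPMap.mkSpanSingleton (1 : A) (1 : ℝ) one_ne_zero
  have mem_f (r : ℝ) : r • (1 : A) ∈ f.domain :=
    Submodule.smul_mem _ _ (Submodule.mem_span_singleton_self _)
  have f_apply (r : ℝ) : f ⟨r • (1 : A), mem_f r⟩ = r :=
    (LinearPMap.mkSpanSingleton'_apply (1 : A) (1 : ℝ) _ r (mem_f r)).trans (mul_one r)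
  have star_alg (r : ℝ) : star (r • (1 : A)) = r • (1 : A) := by simp
  obtain ⟨g, hgf, hgs⟩ := riesz_extension s f
    (by
      rintro ⟨x, hx⟩ hxs
      obtain ⟨r, rfl⟩ := Submodule.mem_span_singleton.1 hx
      obtain ⟨c, hc, hcr⟩ := hxs
      -- The scalar doubles because `c + star c` is twice the real part.
      have := hC c hc (r + r) (by
        rw [Algebra.algebraMap_eq_smul_one, add_smul]
        exact hcr.trans_eq (by rw [star_alg]))
      refine le_of_le_of_eq ?_ (f_apply r).symm
      linarith)
    (by
      intro y
      -- Scalars are cofinal: `y + star y ≥ -‖y + star y‖`.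
      refine ⟨⟨‖y + star y‖ • (1 : A), mem_f _⟩, 0, C.zero_mem, ?_⟩
      have h := (IsSelfAdjoint.add_star_self y).neg_algebraMap_norm_le_self
      have h0 : (0 : A) ≤ ‖y + star y‖ • (1 : A) := smul_nonneg (norm_nonneg _) zero_le_one
      rw [Algebra.algebraMap_eq_smul_one, neg_le_iff_add_nonneg'] at h
      rw [star_zero, add_zero, star_add, star_alg, add_add_add_comm, add_assoc]
      exact add_nonneg h0 h)
  have g_skew {a : A} (ha : a + star a = 0) : g a = 0 := by
    have h₁ := hgs a ⟨0, C.zero_mem, by simp [ha]⟩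
    have h₂ := hgs (-a) ⟨0, C.zero_mem, by simp [← neg_add_rev, add_comm (star a), ha]⟩
    rw [map_neg] at h₂
    linarith
  have g_one : g 1 = 1 := by
    have := hgf ⟨(1 : ℝ) • (1 : A), mem_f 1⟩
    rw [f_apply] at this
    simpa using this
  have im_zero {a : A} (ha : IsSelfAdjoint a) : g (Complex.I • a) = 0 :=
    g_skew (by simp [ha.star_eq])
  have re_apply (a : A) : (Module.Dual.extendRCLike g a : ℂ).re = g a :=
    Module.Dual.re_extendRCLike_apply (𝕜 := ℂ) g a
  have im_apply (a : A) : (Module.Dual.extendRCLike g a : ℂ).im = -g (Complex.I • a) :=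
    Module.Dual.im_extendRCLike_apply (𝕜 := ℂ) g a
  refine ⟨Module.Dual.extendRCLike g, ⟨?_, fun a ha => ?_⟩, fun c hc => ?_⟩
  · apply Complex.ext
    · rw [re_apply, g_one, Complex.one_re]
    · rw [im_apply, im_zero (.one A), neg_zero, Complex.one_im]
  · refine Complex.le_def.2 ⟨?_, ?_⟩
    · rw [re_apply]
      refine hgs a ⟨0, C.zero_mem, ?_⟩
      rw [star_zero, add_zero]
      exact add_nonneg ha (star_nonneg_iff.2 ha)
    · rw [im_apply, im_zero (.of_nonneg ha), neg_zero, Complex.zero_im]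
  · rw [re_apply]
    exact hgs c ⟨c, hc, le_rfl⟩

end State

section BirkhoffJames

variable {A E : Type*} [CStarAlgebra A] [PartialOrder A] [StarOrderedRing A]
  [NormedAddCommGroup E] [NormedSpace ℂ E] [Module Aᵐᵒᵖ E] [CStarModule Aᵐᵒᵖ E]

theorem stateSet.re_rightInner_self_le {φ : A →ₗ[ℂ] ℂ} (hφ : φ ∈ stateSet A) (x : E) :
    (φ (rightInner A x x)).re ≤ ‖x‖ ^ 2 := by
  have h := hφ.2 _ (sub_nonneg.2 (rightInner_self_le (A := A) x))
  rw [map_sub, stateSet.map_algebraMap hφ] at h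
  have := (Complex.le_def.1 h).1
  rw [Complex.zero_re, Complex.sub_re, Complex.ofReal_re] at this
  linarith

theorem norm_le_norm_add_of_state {φ : A →ₗ[ℂ] ℂ} (hφ : φ ∈ stateSet A) {e g : E}
    (he : φ (rightInner A e e) = ((‖e‖ ^ 2 : ℝ) : ℂ)) (hg : φ (rightInner A e g) = 0) :
    ‖e‖ ≤ ‖e + g‖ := by
  have h := stateSet.re_rightInner_self_le hφ (e + g)
  rw [rightInner_add_self, map_add, map_add, map_add, stateSet.map_star hφ, hg, he, star_zero,
    add_zero, add_zero, Complex.add_re, Complex.ofReal_re] at h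
  have h₂ := (Complex.le_def.1 (hφ.2 _ (rightInner_self_nonneg (A := A) g))).1
  rw [Complex.zero_re] at h₂
  exact le_of_sq_le_sq (by linarith) (norm_nonneg _)

/-- The cone generated by the elements `⟨e | f⟩` for `f ∈ F` and by `⟨e | e⟩ - ‖e‖ ^ 2`. -/
noncomputable def birkhoffJamesCone (A : Type*) {E : Type*} [CStarAlgebra A] [PartialOrder A]
    [NormedAddCommGroup E] [NormedSpace ℂ E] [Module Aᵐᵒᵖ E] [CStarModule Aᵐᵒᵖ E]
    (e : E) (F : Submodule ℂ E) : PointedCone ℝ A where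
  carrier := {a | ∃ f ∈ F, ∃ t : ℝ, 0 ≤ t ∧
    a = rightInner A e f + t • (rightInner A e e - algebraMap ℝ A (‖e‖ ^ 2))}
  zero_mem' := ⟨0, F.zero_mem, 0, le_rfl, by simp [rightInner]⟩
  add_mem' := by
    rintro _ _ ⟨f, hf, t, ht, rfl⟩ ⟨g, hg, u, hu, rfl⟩
    refine ⟨f + g, F.add_mem hf hg, t + u, add_nonneg ht hu, ?_⟩
    rw [rightInner_add_right, add_smul, add_add_add_comm]
  smul_mem' := by
    rintro ⟨r, hr⟩ _ ⟨f, hf, t, ht, rfl⟩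
    refine ⟨(r : ℂ) • f, F.smul_mem _ hf, r * t, mul_nonneg hr ht, ?_⟩
    rw [rightInner_smul_right, mul_smul, Complex.coe_smul, ← smul_add]
    rfl

/-- Expanding `⟨e + k f|e + k f⟩` to first order in `k` bounds `‖e + k f‖²` by `‖e‖² + k r + k²
‖f‖²`, which orthogonality keeps at least `‖e‖²`. -/
theorem IsBirkhoffJamesOrthogonalTo.nonneg_of_le_algebraMap [Nontrivial A] {e : E} {F : Submodule ℂ E}
    (h : IsBirkhoffJamesOrthogonalTo e F) {c : A} (hc : c ∈ birkhoffJamesCone A e F) {r : ℝ}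
    (hcr : c + star c ≤ algebraMap ℝ A r) : 0 ≤ r := by
  obtain ⟨f, hf, t, ht, rfl⟩ := hc
  have key {k : ℝ} (hk : 0 ≤ k) (hkt : k * (2 * t) ≤ 1) : 0 ≤ k * r + k ^ 2 * ‖f‖ ^ 2 := by
    set p := rightInner A e e
    have hp : star p = p := star_rightInner e e
    have h₁ : rightInner A (e + (k : ℂ) • f) (e + (k : ℂ) • f) ≤
        algebraMap ℝ A (‖e‖ ^ 2 + (k * r + k ^ 2 * ‖f‖ ^ 2)) := by
      -- The bound is the sum of three inequalities with weights `k`, `1 - 2kt` and `1`; the middle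
      -- weight is why `2kt ≤ 1` is needed.
      have h₂ := smul_le_smul_of_nonneg_left hcr hk
      have h₃ := smul_le_smul_of_nonneg_left (rightInner_self_le (A := A) e)
        (sub_nonneg.2 hkt)
      have h₄ := rightInner_self_le (A := A) ((k : ℂ) • f)
      have h₅ : ‖(k : ℂ) • f‖ ^ 2 = k ^ 2 * ‖f‖ ^ 2 := by
        rw [norm_smul, mul_pow, Complex.norm_real, Real.norm_eq_abs, sq_abs]
      rw [h₅] at h₄
      rw [rightInner_add_self, rightInner_smul_right, Complex.coe_smul, star_smul, star_trivial]
      rw [← sub_nonneg] at h₂ h₃ h₄ ⊢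
      refine (add_nonneg (add_nonneg h₂ h₃) h₄).trans_eq ?_
      simp only [← smul_sub, Algebra.algebraMap_eq_smul_one, star_add, star_smul, star_sub,
        star_trivial, star_one, hp]
      module
    have h₀ := nonneg_of_algebraMap_nonneg ((rightInner_self_nonneg _).trans h₁)
    have h₆ := CStarAlgebra.norm_le_norm_of_nonneg_of_le (rightInner_self_nonneg _) h₁
    rw [norm_rightInner_self, norm_algebraMap', Real.norm_of_nonneg h₀] at h₆
    have h₇ := pow_le_pow_left₀ (norm_nonneg _) (h f hf k) 2
    linarith
  by_contra! hr
  have hf₀ : 0 < ‖f‖ ^ 2 + 1 := by positivity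
  have ht₀ : 0 < 2 * t + 1 := by positivity
  -- The first bound gives `2kt ≤ 1`, the second `r + k ‖f‖² ≤ -k < 0`, contradicting `key`. Each `+
  -- 1` keeps a denominator positive.
  set k := min (1 / (2 * t + 1)) (-r / (‖f‖ ^ 2 + 1))
  have hk : 0 < k := lt_min (by positivity) (div_pos (neg_pos.2 hr) hf₀)
  have hk₁ : k * (2 * t + 1) ≤ 1 := (le_div_iff₀ ht₀).1 (min_le_left _ _)
  have hk₂ : k * (‖f‖ ^ 2 + 1) ≤ -r := (le_div_iff₀ hf₀).1 (min_le_right _ _)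
  have h₁ := key hk.le (by linarith)
  rw [sq, mul_assoc, ← mul_add] at h₁
  have h₂ := nonneg_of_mul_nonneg_right h₁ hk
  linarith

theorem IsBirkhoffJamesOrthogonalTo.exists_state [Nontrivial A] {e : E} {F : Submodule ℂ E}
    (h : IsBirkhoffJamesOrthogonalTo e F) :
    ∃ φ ∈ stateSet A,
      φ (rightInner A e e) = ((‖e‖ ^ 2 : ℝ) : ℂ) ∧ ∀ f ∈ F, φ (rightInner A e f) = 0 := by
  obtain ⟨φ, hφ, hφC⟩ := exists_mem_stateSet_re_nonneg (birkhoffJamesCone A e F)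
    fun c hc r hcr => h.nonneg_of_le_algebraMap hc hcr
  have re_nonneg {f : E} (hf : f ∈ F) : 0 ≤ (φ (rightInner A e f)).re :=
    hφC _ ⟨f, hf, 0, le_rfl, by simp⟩
  -- Taking `k = ±1` and `k = ±i` annihilates the real and imaginary parts.
  have smul_re_nonneg (k : ℂ) {f : E} (hf : f ∈ F) : 0 ≤ (k * φ (rightInner A e f)).re := by
    simpa only [rightInner_smul_right, map_smul, smul_eq_mul] using re_nonneg (F.smul_mem k hf)
  refine ⟨φ, hφ, Complex.ext ?_ ?_, fun f hf => Complex.ext ?_ ?_⟩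
  · refine le_antisymm (stateSet.re_rightInner_self_le hφ e) ?_
    have := hφC _ ⟨0, F.zero_mem, 1, zero_le_one, rfl⟩
    rw [one_smul, map_add, map_sub, stateSet.map_algebraMap hφ] at this
    simpa [rightInner] using this
  · rw [stateSet.im_eq_zero hφ (star_rightInner e e), Complex.ofReal_im]
  · have h₁ := smul_re_nonneg (-1) hf
    have h₂ := smul_re_nonneg 1 hf
    simp at h₁ h₂ ⊢
    linarith
  · have h₁ := smul_re_nonneg Complex.I hf
    have h₂ := smul_re_nonneg (-Complex.I) hf
    simp at h₁ h₂ ⊢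
    linarith

end BirkhoffJames

theorem mainTheorem7 {A E : Type*}
    [CStarAlgebra A] [Nontrivial A] [PartialOrder A] [StarOrderedRing A]
    [NormedAddCommGroup E] [NormedSpace ℂ E] [CompleteSpace E]
    [Module Aᵐᵒᵖ E] [CStarModule Aᵐᵒᵖ E]
    (e : E) (F : Submodule ℂ E) :
    IsBirkhoffJamesOrthogonalTo e F ↔
      ∃ φ ∈ stateSet A,
        φ (rightInner A e e) = ((‖e‖ ^ 2 : ℝ) : ℂ) ∧ ∀ f ∈ F, φ (rightInner A e f) = 0 := by
  refine ⟨fun h => h.exists_state, ?_⟩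
  rintro ⟨φ, hφ, he, hF⟩ f hf k
  exact norm_le_norm_add_of_state hφ he (hF _ (F.smul_mem k hf))
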